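/- Let $n\ge 1$ and $c(x,\bar x)=-\langle x,\bar x\rangle$ on $\mathbf{R}^n\times\mathbf{R}^n$. Let $\mu,\nu$ be probability measures on $\mathbf{R}^n$, absolutely continuous with respect to Lebesgue measure, with bounded supports $\operatorname{spt}\mu$, $\operatorname{spt}\nu$. Suppose $\operatorname{spt}\nu=\overline\Omega_1\cup\overline\Omega_2$ with $\overline\Omega_1,\overline\Omega_2$ nonempty and strongly separated by a hyperplane $\Pi=\{x\mid\langle x,v\rangle=a\}$, where $|v|=1$ and $v$ is oriented towards $\overline\Omega_1$: for some $d>0$, $\langle \bar x_2,v\rangle<a-d<a+d<\langle \bar x_1,v\rangle$ for all $\bar x_1\in\overline\Omega_1$, $\bar x_2\in\overline\Omega_2$. Call $u:\mathbf{R}^n\to\mathbf{R}$ an optimal potential transporting $\mu$ to $\nu$ if $u$ is convex (hence differentiable almost everywhere), $\nabla u$ pushes $\mu$ forward to $\nu$ and minimizes $\int c(x,S(x))\,\mu(dx)$ among all Borel maps $S$ with $S_\#\mu=\nu$, and $\nabla u(x)\in\operatorname{spt}\nu$ at every point $x$ where $u$ is differentiable. Write $\partial u(x)=\{\bar x\mid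 \langle y-x,\bar x\rangle+u(x)\le u(y)\ \forall y\in\mathbf{R}^n\}$. Then an optimal potential exists, and every optimal potential $u$ has the following properties. (1) There are convex functions $u_1,u_2:\mathbf{R}^n\to\mathbf{R}$ with $u=\max\{u_1,u_2\}$ such that, for $i=1,2$, $\nabla u_i(x)\in\overline\Omega_i$ at every point $x$ where $u_i$ is differentiable, and $$\Sigma:=\{x\mid \partial u(x)\cap\overline\Omega_i\ne\emptyset,\ i=1,2\}=\{u_1=u_2\},$$ $$C_1:=\{x\mid\partial u(x)\cap\overline\Omega_2=\emptyset\}=\{u_1>u_2\},\qquad C_2:=\{x\mid\partial u(x)\cap\overline\Omega_1=\emptyset\}=\{u_1<u_2\}.$$ (2) The sets $\Sigma$, $C_1$, $C_2$ are connected, and there is a globally Lipschitz function $h:\Pi\to\mathbf{R}$, which is a difference of two finite convex functions on $\Pi$, such that $$\Sigma=\{p+h(p)v\mid p\in\Pi\},\quad C_1=\{p+tv\mid p\in\Pi,\ t>h(p)\},\quad C_2=\{p+tv\mid p\in\Pi,\ t<h(p)\}.$$ (3) If $\operatorname{spt}\mu$ is convex and $\overline\Omega_i$ is connected for $i=1$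 or $i=2$, then $\operatorname{spt}\mu\cap(C_i\cup\Sigma)$ is connected for that $i$. -/

import Mathlib

open MeasureTheory Set
open scoped NNReal

noncomputable section

namespace DCTears

/-- Euclidean space `ℝⁿ`. -/
abbrev E (n : ℕ) : Type := EuclideanSpace ℝ (Fin n)

/-- The cost `c(x, y) = -⟨x, y⟩`. -/
def cost {n : ℕ} (x y : E n) : ℝ := -inner ℝ x y

/-- `T` is a (Borel) map pushing `μ` forward to `ν` and minimizing the transport cost among
all such maps. -/
structure IsOptimalMap {n : ℕ} (μ ν : Measure (E n)) (T : E n → E n) : Prop where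
  measurePreserving : MeasurePreserving T μ ν
  le : ∀ S : E n → E n, MeasurePreserving S μ ν →
    ∫ x, cost x (T x) ∂μ ≤ ∫ x, cost x (S x) ∂μ

/-- `u` is an optimal potential transporting `μ` to `ν` with cost `-⟨x, y⟩`: a finite convex
function on `ℝⁿ`, differentiable almost everywhere, whose gradient is an optimal map from `μ` to
`ν` and takes values in `spt ν` at all points where it exists. (The Mathlib gradient is `0` where
`u` is not differentiable; this concerns a Lebesgue null set only.) -/
structure IsOptimalPotential {n : ℕ} (μ ν : Measure (E n)) (u : E n → ℝ) : Prop where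
  convexOn : ConvexOn ℝ univ u
  ae_differentiableAt : ∀ᵐ x, DifferentiableAt ℝ u x
  isOptimalMap : IsOptimalMap μ ν (gradient u)
  gradient_mem : ∀ x, DifferentiableAt ℝ u x → gradient u x ∈ ν.support

/-- The subdifferential of a finite convex function at `x₀`. -/
def subdiff {n : ℕ} (u : E n → ℝ) (x₀ : E n) : Set (E n) :=
  {p | ∀ x, inner ℝ (x - x₀) p + u x₀ ≤ u x}

/-- The hyperplane `{⟨x, v⟩ = a}`. -/
def hyperplane {n : ℕ} (v : E n) (a : ℝ) : Set (E n) := {x | inner ℝ x v = a}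

/-- The hyperplane `{⟨x, v⟩ = a}` with unit normal `v` strongly separates `A` and `B`,
with `v` pointing from `A` towards `B`. -/
def StronglySeparates {n : ℕ} (v : E n) (a : ℝ) (A B : Set (E n)) : Prop :=
  ‖v‖ = 1 ∧ ∃ d : ℝ, 0 < d ∧
    ∀ x₁ ∈ A, ∀ x₂ ∈ B, inner ℝ x₁ v < a - d ∧ a + d < inner ℝ x₂ v

/-- `h` is a difference of two finite convex functions on `P`. -/
def IsDCOn {n : ℕ} (P : Set (E n)) (h : E n → ℝ) : Prop :=
  ∃ f g : E n → ℝ, ConvexOn ℝ P f ∧ ConvexOn ℝ P g ∧ ∀ p ∈ P, h p = f p - g p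

/-- The graph of `h : P → ℝ` in the direction `v`. -/
def graphOver {n : ℕ} (v : E n) (P : Set (E n)) (h : E n → ℝ) : Set (E n) :=
  {x | ∃ p ∈ P, x = p + h p • v}

/-- The open epigraph of `h : P → ℝ` in the direction `v`. -/
def openEpigraphOver {n : ℕ} (v : E n) (P : Set (E n)) (h : E n → ℝ) : Set (E n) :=
  {x | ∃ p ∈ P, ∃ t : ℝ, h p < t ∧ x = p + t • v}

/-- The open subgraph of `h : P → ℝ` in the direction `v`. -/
def openSubgraphOver {n : ℕ} (v : E n) (P : Set (E n)) (h : E n → ℝ) : Set (E n) :=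
  {x | ∃ p ∈ P, ∃ t : ℝ, t < h p ∧ x = p + t • v}

/-- The tear `Σ`: points whose subdifferential meets both pieces. -/
def tear {n : ℕ} (u : E n → ℝ) (Ω₁ Ω₂ : Set (E n)) : Set (E n) :=
  {x | (subdiff u x ∩ Ω₁).Nonempty ∧ (subdiff u x ∩ Ω₂).Nonempty}

/-- The points whose subdifferential misses the piece `Ω'`; so `C₁ = missing u Ω₂` and
`C₂ = missing u Ω₁`. -/
def missing {n : ℕ} (u : E n → ℝ) (Ω' : Set (E n)) : Set (E n) :=
  {x | subdiff u x ∩ Ω' = ∅}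

end DCTears

end

/-!
Existence: a minimiser `ψ` of Kantorovich's dual functional exists by compactness, and by the
envelope theorem the vanishing of the first variation at `ψ` says that the gradient of the Legendre
transform of `ψ` pushes `μ` forward to `ν`. This gradient is optimal by weak duality.

Structure: by compactness every `q ∈ spt ν` is a subgradient of `u` at some point of `spt μ`, so
the supremum `uᵢ` of the supporting affine functions of `u` with slopes in `Ωᵢ` is finite, and
`u = max u₁ u₂`. The slopes of `u₁` and `u₂` in the direction `v` are separated by a gap, so
`u₁ - u₂` grows at least linearly along `v` and vanishes at a height `h` depending on the line in
a Lipschitz way. For `s` in the gap, `u (p + t • v) - t * s` is minimal at `t = h p`, and this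
minimum is convex in `p`; two values of `s` give convex functions that differ by a multiple of `h`.

Connectedness: for `q ∈ Ωᵢ` the points of `spt μ` with `q` as a subgradient form a nonempty convex
set, and these sets vary with `q` in a closed way, so their union over the connected set `Ωᵢ` is
connected.
-/
namespace DCTears

open Filter Topology

section MaxValue

variable {Y : Type*} [TopologicalSpace Y] [CompactSpace Y]

/-- The maximum of a continuous function on a compact space (`0` if the space is empty). -/
noncomputable def maxValue (f : C(Y, ℝ)) : ℝ := ⨆ y, f y

lemma le_maxValue (f : C(Y, ℝ)) (y : Y) : f y ≤ maxValue f :=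
  le_ciSup (isCompact_range f.continuous).bddAbove y

lemma exists_eq_maxValue [Nonempty Y] (f : C(Y, ℝ)) : ∃ y, f y = maxValue f := by
  obtain ⟨y, -, hy⟩ := isCompact_univ.exists_isMaxOn univ_nonempty f.continuous.continuousOn
  exact ⟨y, le_antisymm (le_maxValue f y) (ciSup_le fun z => hy (mem_univ z))⟩

lemma lipschitzWith_maxValue : LipschitzWith 1 (maxValue : C(Y, ℝ) → ℝ) := by
  refine LipschitzWith.of_le_add fun f g => ?_
  rcases isEmpty_or_nonempty Y with hY | hY
  · simp [maxValue]
  obtain ⟨y, hy⟩ := exists_eq_maxValue f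
  have hfg : f y - g y ≤ dist f g := (le_abs_self _).trans (f.dist_apply_le_dist y)
  linarith [le_maxValue g y]

lemma tendsto_of_tendsto_comp {ι Z : Type*} [TopologicalSpace Z] [T2Space Z] {f : Y → Z}
    (hf : Continuous f) {p : Y} (hp : ∀ y, f y = f p → y = p) {l : Filter ι} {q : ι → Y}
    (hq : Tendsto (f ∘ q) l (𝓝 (f p))) : Tendsto q l (𝓝 p) := by
  have hfiber : f ⁻¹' {f p} = {p} := Subset.antisymm hp (by simp)
  rwa [← nhdsSet_singleton, ← hfiber, ← hf.isClosedMap.comap_nhds_eq hf, tendsto_comap_iff]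

lemma tendsto_of_maxValue_add_smul (f η : C(Y, ℝ)) {p : Y}
    (hp : ∀ y, f y = maxValue f ↔ y = p) {q : ℝ → Y}
    (hq : ∀ ε, (f + ε • η) (q ε) = maxValue (f + ε • η)) : Tendsto q (𝓝 0) (𝓝 p) := by
  have hfp : f p = maxValue f := (hp p).2 rfl
  refine tendsto_of_tendsto_comp f.continuous (fun y hy => (hp y).1 (hy.trans hfp)) ?_
  have hmax : Tendsto (fun ε : ℝ => maxValue (f + ε • η) - ε * η (q ε)) (𝓝 0) (𝓝 (f p)) := by
    have hcont : Continuous fun ε : ℝ => maxValue (f + ε • η) :=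
      lipschitzWith_maxValue.continuous.comp (by fun_prop)
    have hbdd : Tendsto (fun ε : ℝ => ε * η (q ε)) (𝓝 0) (𝓝 0) :=
      tendsto_id.zero_mul_isBoundedUnder_le
        (isBoundedUnder_of ⟨‖η‖, fun ε => η.norm_coe_le_norm (q ε)⟩)
    simpa [hfp] using (hcont.tendsto 0).sub hbdd
  refine hmax.congr fun ε => ?_
  rw [← hq, ContinuousMap.add_apply, ContinuousMap.smul_apply, smul_eq_mul, add_sub_cancel_right,
    Function.comp_apply]

-- The envelope theorem: a maximiser of `f + ε • η` approaches `p`, so that moving it from `p`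
-- changes the value by `o(ε)`.
lemma hasDerivAt_maxValue_add_smul (f η : C(Y, ℝ)) {p : Y}
    (hp : ∀ y, f y = maxValue f ↔ y = p) :
    HasDerivAt (fun ε : ℝ => maxValue (f + ε • η)) (η p) 0 := by
  have : Nonempty Y := ⟨p⟩
  choose q hq using fun ε : ℝ => exists_eq_maxValue (f + ε • η)
  have hdiff : Tendsto (fun ε => η (q ε) - η p) (𝓝 0) (𝓝 0) := by
    simpa using ((η.continuous.tendsto p).comp
      (tendsto_of_maxValue_add_smul f η hp hq)).sub_const (η p)
  rw [hasDerivAt_iff_isLittleO_nhds_zero]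
  refine Asymptotics.IsBigO.trans_isLittleO (g := fun ε => (η (q ε) - η p) * ε)
    (Asymptotics.isBigO_of_le _ fun ε => ?_) ?_
  · have hlower := le_maxValue (f + ε • η) p
    have hupper := le_maxValue f (q ε)
    rw [← (hp p).2 rfl] at hupper
    have hvalue := hq ε
    simp only [ContinuousMap.add_apply, ContinuousMap.smul_apply, smul_eq_mul] at hlower hvalue
    simp only [zero_add, zero_smul, add_zero, smul_eq_mul, ← (hp p).2 rfl, Real.norm_eq_abs,
      sub_mul]
    exact abs_le_abs_of_nonneg (by linarith) (by linarith)
  · simpa using ((Asymptotics.isLittleO_one_iff ℝ).2 hdiff).mul_isBigO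
      (Asymptotics.isBigO_refl (fun ε : ℝ => ε) (𝓝 0))

end MaxValue

section CTransform

variable {X Y : Type*} [TopologicalSpace X] [TopologicalSpace Y] [CompactSpace Y]

/-- The generalized Legendre transform `x ↦ max_y (b(x, y) - ψ(y))` with respect to a pairing
`b`, which plays the role of minus a transport cost. -/
noncomputable def cTransform (b : C(X × Y, ℝ)) (ψ : C(Y, ℝ)) : C(X, ℝ) where
  toFun x := maxValue (b.curry x - ψ)
  continuous_toFun := lipschitzWith_maxValue.continuous.comp (by fun_prop)

lemma sub_le_cTransform (b : C(X × Y, ℝ)) (ψ : C(Y, ℝ)) (x : X) (y : Y) :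
    b (x, y) - ψ y ≤ cTransform b ψ x :=
  le_maxValue (b.curry x - ψ) y

lemma exists_sub_eq_cTransform [Nonempty Y] (b : C(X × Y, ℝ)) (ψ : C(Y, ℝ)) (x : X) :
    ∃ y, b (x, y) - ψ y = cTransform b ψ x :=
  exists_eq_maxValue (b.curry x - ψ)

lemma dist_cTransform_apply_le (b : C(X × Y, ℝ)) (ψ : C(Y, ℝ)) (x x' : X) :
    dist (cTransform b ψ x) (cTransform b ψ x') ≤ dist (b.curry x) (b.curry x') :=
  (lipschitzWith_maxValue.dist_le_mul (b.curry x - ψ) (b.curry x' - ψ)).trans_eq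
    (by rw [NNReal.coe_one, one_mul, dist_sub_right])

lemma dist_cTransform_apply_le_dist (b : C(X × Y, ℝ)) (ψ ψ' : C(Y, ℝ)) (x : X) :
    dist (cTransform b ψ x) (cTransform b ψ' x) ≤ dist ψ ψ' :=
  (lipschitzWith_maxValue.dist_le_mul (b.curry x - ψ) (b.curry x - ψ')).trans_eq
    (by rw [NNReal.coe_one, one_mul, dist_sub_left])

lemma lipschitzWith_cTransform [CompactSpace X] (b : C(X × Y, ℝ)) :
    LipschitzWith 1 (cTransform b) := by
  refine LipschitzWith.of_dist_le_mul fun ψ ψ' => ?_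
  rw [NNReal.coe_one, one_mul, ContinuousMap.dist_le dist_nonneg]
  exact dist_cTransform_apply_le_dist b ψ ψ'

lemma cTransform_swap_cTransform_le [CompactSpace X] [Nonempty X] (b : C(X × Y, ℝ))
    (ψ : C(Y, ℝ)) : cTransform (b.comp .prodSwap) (cTransform b ψ) ≤ ψ := by
  refine ContinuousMap.le_def.2 fun y => ?_
  obtain ⟨x, hx⟩ := exists_sub_eq_cTransform (b.comp .prodSwap) (cTransform b ψ) y
  rw [← hx]
  have := sub_le_cTransform b ψ x y
  simp only [ContinuousMap.comp_apply, ContinuousMap.prodSwap_apply]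
  linarith

lemma cTransform_sub_const [Nonempty Y] (b : C(X × Y, ℝ)) (ψ : C(Y, ℝ)) (c : ℝ) (x : X) :
    cTransform b (ψ - .const Y c) x = cTransform b ψ x + c := by
  obtain ⟨y, hy⟩ := exists_sub_eq_cTransform b ψ x
  obtain ⟨z, hz⟩ := exists_sub_eq_cTransform b (ψ - .const Y c) x
  have hle := sub_le_cTransform b (ψ - .const Y c) x y
  have hge := sub_le_cTransform b ψ x z
  simp only [ContinuousMap.sub_apply, ContinuousMap.const_apply] at hle hz
  linarith

end CTransform

section KantorovichDual

lemma isCompact_setOf_dist_le_dist {Y Z : Type*} [TopologicalSpace Y] [PseudoMetricSpace Z]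
    (B : C(Y, Z)) (y₀ : Y) :
    IsCompact {ψ : C(Y, ℝ) | ψ y₀ = 0 ∧ ∀ p q, dist (ψ p) (ψ q) ≤ dist (B p) (B q)} := by
  set S : Set C(Y, ℝ) := {ψ | ψ y₀ = 0 ∧ ∀ p q, dist (ψ p) (ψ q) ≤ dist (B p) (B q)}
  set S' : Set (Y → ℝ) := {f | f y₀ = 0 ∧ ∀ p q, dist (f p) (f q) ≤ dist (B p) (B q)}
  have hequi : Equicontinuous ((↑) : S → Y → ℝ) := fun y => by
    refine Metric.equicontinuousAt_iff_right.2 fun ε hε => ?_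
    have hB : ∀ᶠ z in 𝓝 y, dist (B y) (B z) < ε := by
      simpa only [dist_comm] using Metric.tendsto_nhds.1 (B.continuous.tendsto y) ε hε
    exact hB.mono fun z hz ψ => (ψ.2.2 y z).trans_lt hz
  have himage : ContinuousMap.toFun '' S = S' := by
    refine Subset.antisymm (image_subset_iff.2 fun ψ hψ => hψ) fun f hf => ?_
    have hcont : Continuous f := continuous_iff_continuousAt.2 fun y =>
      tendsto_iff_dist_tendsto_zero.2 <| squeeze_zero (fun _ => dist_nonneg) (fun z => hf.2 z y)
        (tendsto_iff_dist_tendsto_zero.1 (B.continuous.tendsto y))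
    exact ⟨⟨f, hcont⟩, hf, rfl⟩
  have hclosed : IsClosed S' := by
    simp only [S', ofPred_and, ofPred_forall]
    exact (isClosed_eq (by fun_prop) (by fun_prop)).inter <| isClosed_iInter fun p =>
      isClosed_iInter fun q => isClosed_le (by fun_prop) (by fun_prop)
  refine ArzelaAscoli.isCompact_of_equicontinuous S (himage ▸ ?_) hequi
  refine (isCompact_univ_pi fun y => isCompact_closedBall (0 : ℝ)
    (dist (B y) (B y₀))).of_isClosed_subset hclosed fun f hf y _ => ?_
  exact hf.1 ▸ hf.2 y y₀

variable {X Y : Type*} [TopologicalSpace X] [CompactSpace X] [MeasurableSpace X]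
  [OpensMeasurableSpace X] [TopologicalSpace Y] [CompactSpace Y] [MeasurableSpace Y]

lemma integrable_continuousMap (φ : C(X, ℝ)) (μ : Measure X) [IsFiniteMeasure μ] :
    Integrable φ μ :=
  φ.continuous.integrable_of_hasCompactSupport (.of_compactSpace φ)

lemma continuous_integral_continuousMap (μ : Measure X) [IsFiniteMeasure μ] :
    Continuous fun φ : C(X, ℝ) => ∫ x, φ x ∂μ := by
  refine (LipschitzWith.of_dist_le_mul (K := (μ univ).toNNReal) fun φ ψ => ?_).continuous
  rw [dist_eq_norm, ← integral_sub (integrable_continuousMap φ μ) (integrable_continuousMap ψ μ),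
    mul_comm]
  exact norm_integral_le_of_norm_le_const (.of_forall fun x => φ.dist_apply_le_dist x)

/-- The functional minimised in Kantorovich's dual problem, for the reward `b`. -/
noncomputable def dualFunctional (b : C(X × Y, ℝ)) (μ : Measure X) (ν : Measure Y)
    (ψ : C(Y, ℝ)) : ℝ :=
  ∫ x, cTransform b ψ x ∂μ + ∫ y, ψ y ∂ν

variable [OpensMeasurableSpace Y] (b : C(X × Y, ℝ)) (μ : Measure X) (ν : Measure Y)

lemma continuous_dualFunctional [IsFiniteMeasure μ] [IsFiniteMeasure ν] :
    Continuous (dualFunctional b μ ν) :=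
  ((continuous_integral_continuousMap μ).comp (lipschitzWith_cTransform b).continuous).add
    (continuous_integral_continuousMap ν)

lemma dualFunctional_sub_const [IsProbabilityMeasure μ] [IsProbabilityMeasure ν] [Nonempty Y]
    (ψ : C(Y, ℝ)) (c : ℝ) :
    dualFunctional b μ ν (ψ - .const Y c) = dualFunctional b μ ν ψ := by
  simp only [dualFunctional, cTransform_sub_const, ContinuousMap.sub_apply,
    ContinuousMap.const_apply]
  rw [integral_add (integrable_continuousMap _ μ) (integrable_const c),
    integral_sub (integrable_continuousMap ψ ν) (integrable_const c)]
  simp only [integral_const, probReal_univ, one_smul]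
  ring

lemma dualFunctional_cTransform_cTransform_le [IsFiniteMeasure μ] [IsFiniteMeasure ν]
    [Nonempty X] [Nonempty Y] (ψ : C(Y, ℝ)) :
    dualFunctional b μ ν (cTransform (b.comp .prodSwap) (cTransform b ψ)) ≤
      dualFunctional b μ ν ψ := by
  refine add_le_add (integral_mono (integrable_continuousMap _ μ) (integrable_continuousMap _ μ) ?_)
    (integral_mono (integrable_continuousMap _ ν) (integrable_continuousMap ψ ν) ?_)
  · exact cTransform_swap_cTransform_le (b.comp .prodSwap) (cTransform b ψ)
  · exact cTransform_swap_cTransform_le b ψ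

-- Replacing `ψ` by its double transform and normalising it at a point does not increase the
-- functional, and confines the search to a compact set.
lemma exists_forall_dualFunctional_le [IsProbabilityMeasure μ] [IsProbabilityMeasure ν] :
    ∃ ψ, ∀ ψ', dualFunctional b μ ν ψ ≤ dualFunctional b μ ν ψ' := by
  have := nonempty_of_isProbabilityMeasure μ
  obtain ⟨y₀⟩ := nonempty_of_isProbabilityMeasure ν
  have : Nonempty Y := ⟨y₀⟩
  obtain ⟨ψ, -, hmin⟩ := (isCompact_setOf_dist_le_dist (b.comp .prodSwap).curry y₀).exists_isMinOn
    ⟨0, rfl, fun p q => by simp⟩ (continuous_dualFunctional b μ ν).continuousOn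
  refine ⟨ψ, fun ψ' => ?_⟩
  let χ := cTransform (b.comp .prodSwap) (cTransform b ψ')
  calc dualFunctional b μ ν ψ ≤ dualFunctional b μ ν (χ - .const Y (χ y₀)) :=
        hmin ⟨sub_self _, fun p q => by
          simpa only [ContinuousMap.sub_apply, ContinuousMap.const_apply, dist_sub_right] using
            dist_cTransform_apply_le (b.comp .prodSwap) (cTransform b ψ') p q⟩
    _ = dualFunctional b μ ν χ := dualFunctional_sub_const b μ ν χ _
    _ ≤ dualFunctional b μ ν ψ' := dualFunctional_cTransform_cTransform_le b μ ν ψ'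

variable {b μ ν} [IsFiniteMeasure μ]

lemma hasDerivAt_integral_cTransform {ψ : C(Y, ℝ)} {T : X → Y} (hT : AEMeasurable T μ)
    (hmax : ∀ᵐ x ∂μ, ∀ y, b (x, y) - ψ y = cTransform b ψ x ↔ y = T x) (η : C(Y, ℝ)) :
    HasDerivAt (fun ε : ℝ => ∫ x, cTransform b (ψ + ε • η) x ∂μ) (-∫ x, η (T x) ∂μ) 0 := by
  rw [← integral_neg]
  refine (hasDerivAt_integral_of_dominated_loc_of_lip (𝕜 := ℝ)
    (F := fun ε x => cTransform b (ψ + ε • η) x) (bound := fun _ => ‖η‖)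
    univ_mem ?_ (integrable_continuousMap _ μ) ?_ ?_ (integrable_const _) ?_).2
  · exact .of_forall fun ε => (integrable_continuousMap _ μ).aestronglyMeasurable
  · exact (η.continuous.measurable.comp_aemeasurable hT).aestronglyMeasurable.neg
  · refine .of_forall fun x => (LipschitzWith.of_dist_le_mul fun ε ε' => ?_).lipschitzOnWith
    refine (dist_cTransform_apply_le_dist b (ψ + ε • η) (ψ + ε' • η) x).trans_eq ?_
    simp only [dist_eq_norm, add_sub_add_left_eq_sub, ← sub_smul, norm_smul, Real.coe_nnabs,
      abs_norm, mul_comm]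
  · filter_upwards [hmax] with x hx
    have henvelope := hasDerivAt_maxValue_add_smul (b.curry x - ψ) (-η) hx
    refine henvelope.congr_of_eventuallyEq (.of_forall fun ε => ?_)
    change maxValue _ = maxValue _
    rw [smul_neg, sub_add_eq_sub_sub, sub_eq_add_neg _ (ε • η)]

end KantorovichDual

lemma map_eq_of_forall_dualFunctional_le {X Y : Type*} [TopologicalSpace X] [CompactSpace X]
    [MeasurableSpace X] [OpensMeasurableSpace X] [TopologicalSpace Y] [CompactSpace Y]
    [MeasurableSpace Y] [BorelSpace Y] [HasOuterApproxClosed Y] {b : C(X × Y, ℝ)} {μ : Measure X}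
    {ν : Measure Y} [IsFiniteMeasure μ] [IsFiniteMeasure ν] {ψ : C(Y, ℝ)}
    (hψ : ∀ ψ', dualFunctional b μ ν ψ ≤ dualFunctional b μ ν ψ') {T : X → Y}
    (hT : AEMeasurable T μ)
    (hmax : ∀ᵐ x ∂μ, ∀ y, b (x, y) - ψ y = cTransform b ψ x ↔ y = T x) : μ.map T = ν := by
  refine ext_of_forall_integral_eq_of_IsFiniteMeasure fun η => ?_
  rw [integral_map hT η.continuous.aestronglyMeasurable]
  have hν : HasDerivAt (fun ε : ℝ => ∫ y, (ψ + ε • η.toContinuousMap) y ∂ν) (∫ y, η y ∂ν) 0 := by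
    have hlinear : ∀ ε : ℝ, ∫ y, (ψ + ε • η.toContinuousMap) y ∂ν =
        ∫ y, ψ y ∂ν + ε * ∫ y, η y ∂ν := fun ε => by
      rw [← integral_const_mul]
      exact integral_add (integrable_continuousMap ψ ν)
        ((integrable_continuousMap η.toContinuousMap ν).const_mul ε)
    simpa only [hlinear] using (hasDerivAt_mul_const _).const_add _
  have hmin : IsLocalMin (fun ε : ℝ => dualFunctional b μ ν (ψ + ε • η.toContinuousMap)) 0 :=
    .of_forall fun ε => by simpa only [zero_smul, add_zero] using hψ _
  have hzero := hmin.hasDerivAt_eq_zero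
    ((hasDerivAt_integral_cTransform hT hmax η.toContinuousMap).add hν)
  exact neg_add_eq_zero.1 hzero

section Subgradients

variable {n : ℕ} {u : E n → ℝ} {Ω : Set (E n)}

lemma gradient_mem_subdiff (hu : ConvexOn ℝ univ u) {x : E n} (hx : DifferentiableAt ℝ u x) :
    gradient u x ∈ subdiff u x := by
  intro y
  let line : ℝ →ᵃ[ℝ] E n := AffineMap.lineMap x y
  have hconvex : ConvexOn ℝ univ (u ∘ line) := by
    simpa only [preimage_univ] using hu.comp_affineMap line
  have hderiv : HasDerivAt (u ∘ line) (fderiv ℝ u x (y - x)) 0 := by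
    have hfderiv : HasFDerivAt u (fderiv ℝ u x) (line 0) := by
      simpa only [line, AffineMap.lineMap_apply_zero] using hx.hasFDerivAt
    exact hfderiv.comp_hasDerivAt 0 AffineMap.hasDerivAt_lineMap
  have hslope := hconvex.le_slope_of_hasDerivAt (mem_univ 0) (mem_univ 1) zero_lt_one hderiv
  simp only [slope_def_field, Function.comp_apply, line, AffineMap.lineMap_apply_one,
    AffineMap.lineMap_apply_zero, sub_zero, div_one] at hslope
  rw [real_inner_comm, gradient, InnerProductSpace.toDual_symm_apply]
  linarith

lemma eq_gradient_of_mem_subdiff {x p : E n} (hx : DifferentiableAt ℝ u x)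
    (hp : p ∈ subdiff u x) : p = gradient u x := by
  have hmin : IsLocalMin (fun y => u y - innerSL ℝ p y) x := by
    refine .of_forall fun y => ?_
    have hy := hp y
    rw [inner_sub_left, real_inner_comm, real_inner_comm p x] at hy
    simp only [innerSL_apply_apply]
    linarith
  have hfderiv := hmin.hasFDerivAt_eq_zero (hx.hasFDerivAt.sub (innerSL ℝ p).hasFDerivAt)
  rw [gradient, eq_comm, LinearIsometryEquiv.symm_apply_eq, sub_eq_zero.1 hfderiv]
  rfl

lemma isClosed_setOf_mem_subdiff (hu : Continuous u) :
    IsClosed {z : E n × E n | z.2 ∈ subdiff u z.1} := by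
  simp only [subdiff, mem_ofPred_eq]
  rw [ofPred_forall]
  exact isClosed_iInter fun y => isClosed_le (by fun_prop) (by fun_prop)

lemma convex_setOf_mem_subdiff (hu : ConvexOn ℝ univ u) (q : E n) :
    Convex ℝ {x | q ∈ subdiff u x} := by
  intro x hx y hy s t hs ht hst z
  have hconvex := hu.2 (mem_univ x) (mem_univ y) hs ht hst
  have hsx := mul_le_mul_of_nonneg_left (hx z) hs
  have hty := mul_le_mul_of_nonneg_left (hy z) ht
  simp only [inner_sub_left, inner_add_left, real_inner_smul_left, smul_eq_mul] at *
  obtain rfl : t = 1 - s := by linarith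
  linarith

/-- `u` has a subgradient in `Ω` at every point; thus `u` is a supremum of affine functions with
slopes in `Ω`. -/
def HasSubgradientsIn (Ω : Set (E n)) (u : E n → ℝ) : Prop :=
  ∀ x, (subdiff u x ∩ Ω).Nonempty

lemma HasSubgradientsIn.convexOn (hu : HasSubgradientsIn Ω u) : ConvexOn ℝ univ u := by
  refine ⟨convex_univ, fun x _ y _ s t hs ht hst => ?_⟩
  obtain ⟨p, hp, -⟩ := hu (s • x + t • y)
  have hsx := mul_le_mul_of_nonneg_left (hp x) hs
  have hty := mul_le_mul_of_nonneg_left (hp y) ht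
  simp only [inner_sub_left, inner_add_left, real_inner_smul_left, smul_eq_mul] at hsx hty ⊢
  obtain rfl : t = 1 - s := by linarith
  linarith

lemma HasSubgradientsIn.exists_lipschitzWith (hu : HasSubgradientsIn Ω u)
    (hΩ : Bornology.IsBounded Ω) : ∃ C : ℝ≥0, LipschitzWith C u := by
  obtain ⟨R, hR⟩ := hΩ.exists_norm_le
  refine ⟨R.toNNReal, LipschitzWith.of_le_add_mul _ fun x y => ?_⟩
  obtain ⟨p, hp, hpΩ⟩ := hu x
  have hcauchy : -(‖y - x‖ * ‖p‖) ≤ inner ℝ (y - x) p :=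
    neg_le_of_abs_le (abs_real_inner_le_norm _ _)
  have hbound : ‖y - x‖ * ‖p‖ ≤ ‖y - x‖ * R.toNNReal := by
    gcongr
    exact (hR p hpΩ).trans (Real.le_coe_toNNReal R)
  rw [dist_comm, dist_eq_norm]
  linarith [hp y]

lemma HasSubgradientsIn.gradient_mem (hu : HasSubgradientsIn Ω u) {x : E n}
    (hx : DifferentiableAt ℝ u x) : gradient u x ∈ Ω := by
  obtain ⟨p, hp, hpΩ⟩ := hu x
  rwa [← eq_gradient_of_mem_subdiff hx hp]

lemma isClosed_setOf_exists_mem {X Y : Type*} [TopologicalSpace X] [TopologicalSpace Y] {A : Set X}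
    (hA : IsCompact A) {G : Set (X × Y)} (hG : IsClosed G) :
    IsClosed {y | ∃ x ∈ A, (x, y) ∈ G} := by
  have : CompactSpace A := isCompact_iff_compactSpace.1 hA
  have himage : {y | ∃ x ∈ A, (x, y) ∈ G} =
      Prod.snd '' ((fun z : A × Y => ((z.1 : X), z.2)) ⁻¹' G) := by
    ext y
    simp
  rw [himage]
  exact isClosedMap_snd_of_compactSpace _ (hG.preimage (by fun_prop))

end Subgradients

section Legendre

variable {n : ℕ}

/-- The pairing `⟨x, q⟩` of points of the space with points of `K`. -/
noncomputable def innerPairing (K : Set (E n)) : C(E n × K, ℝ) :=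
  ⟨fun z => inner ℝ z.1 z.2, by fun_prop⟩

variable {K : Set (E n)} [CompactSpace K]

/-- The Legendre transform `x ↦ max_{q ∈ K} (⟨x, q⟩ - ψ q)` of a continuous function on a compact
set `K`. -/
noncomputable def legendre (ψ : C(K, ℝ)) : C(E n, ℝ) :=
  cTransform (innerPairing K) ψ

lemma inner_sub_le_legendre (ψ : C(K, ℝ)) (x : E n) (q : K) :
    inner ℝ x q - ψ q ≤ legendre ψ x :=
  sub_le_cTransform (innerPairing K) ψ x q

lemma exists_inner_sub_eq_legendre [Nonempty K] (ψ : C(K, ℝ)) (x : E n) :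
    ∃ q : K, inner ℝ x q - ψ q = legendre ψ x :=
  exists_sub_eq_cTransform (innerPairing K) ψ x

lemma mem_subdiff_legendre {ψ : C(K, ℝ)} {x : E n} {q : K}
    (hq : inner ℝ x q - ψ q = legendre ψ x) : (q : E n) ∈ subdiff (legendre ψ) x := by
  intro y
  rw [inner_sub_left, ← hq]
  linarith [inner_sub_le_legendre ψ y q]

lemma hasSubgradientsIn_legendre [Nonempty K] (ψ : C(K, ℝ)) :
    HasSubgradientsIn K (legendre ψ) := fun x => by
  obtain ⟨q, hq⟩ := exists_inner_sub_eq_legendre ψ x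
  exact ⟨q, mem_subdiff_legendre hq, q.2⟩

lemma inner_sub_eq_legendre_iff {ψ : C(K, ℝ)} {x : E n} (hx : DifferentiableAt ℝ (legendre ψ) x)
    {q : K} : inner ℝ x q - ψ q = legendre ψ x ↔ (q : E n) = gradient (legendre ψ) x := by
  refine ⟨fun hq => eq_gradient_of_mem_subdiff hx (mem_subdiff_legendre hq), fun hq => ?_⟩
  have : Nonempty K := ⟨q⟩
  obtain ⟨p, hp⟩ := exists_inner_sub_eq_legendre ψ x
  obtain rfl : p = q :=
    Subtype.ext ((eq_gradient_of_mem_subdiff hx (mem_subdiff_legendre hp)).trans hq.symm)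
  exact hp

lemma legendre_restrict_eq {u : C(E n, ℝ)} {x q : E n} (hx : x ∈ K) (hq : q ∈ subdiff u x) :
    legendre (u.restrict K) q = inner ℝ x q - u x := by
  have : Nonempty K := ⟨⟨x, hx⟩⟩
  obtain ⟨y, hy⟩ := exists_inner_sub_eq_legendre (u.restrict K) q
  have hle := inner_sub_le_legendre (u.restrict K) q ⟨x, hx⟩
  have hqy := hq y
  rw [inner_sub_left] at hqy
  rw [real_inner_comm, ContinuousMap.restrict_apply] at hle hy
  linarith

end Legendre

section OptimalPotentials

lemma integrable_of_isCompact_support {X : Type*} [TopologicalSpace X] [MeasurableSpace X]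
    [T2Space X] [OpensMeasurableSpace X] [HereditarilyLindelofSpace X] {μ : Measure X}
    [IsFiniteMeasure μ] (hμ : IsCompact μ.support) {f : X → ℝ} (hf : Continuous f) :
    Integrable f μ := by
  rw [← Measure.restrict_eq_self_of_ae_mem (s := μ.support) Measure.support_mem_ae]
  exact hf.continuousOn.integrableOn_compact hμ

-- Weak duality: both sides are compared with `∫ φ ∂μ + ∫ ψ ∂ν`.
lemma integral_le_integral_of_le_add_comp {X Y : Type*} [MeasurableSpace X] [MeasurableSpace Y]
    {μ : Measure X} {ν : Measure Y} {S T : X → Y} (hS : MeasurePreserving S μ ν)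
    (hT : MeasurePreserving T μ ν) {φ : X → ℝ} (hφ : Integrable φ μ) {ψ : Y → ℝ}
    (hψ : Integrable ψ ν) {f g : X → ℝ} (hf : Integrable f μ) (hle : ∀ᵐ x ∂μ, f x ≤ φ x + ψ (S x))
    (heq : ∀ᵐ x ∂μ, φ x + ψ (T x) = g x) : ∫ x, f x ∂μ ≤ ∫ x, g x ∂μ := by
  have hsum : ∀ R : X → Y, MeasurePreserving R μ ν →
      ∫ x, φ x + ψ (R x) ∂μ = ∫ x, φ x ∂μ + ∫ y, ψ y ∂ν := fun R hR => by
    rw [integral_add (g := fun x => ψ (R x)) hφ (hR.integrable_comp_of_integrable hψ), ← hR.map_eq,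
      integral_map hR.measurable.aemeasurable (hR.map_eq ▸ hψ.aestronglyMeasurable)]
  calc ∫ x, f x ∂μ ≤ ∫ x, φ x + ψ (S x) ∂μ :=
        integral_mono_ae hf (hφ.add (hS.integrable_comp_of_integrable hψ)) hle
    _ = ∫ x, φ x + ψ (T x) ∂μ := by rw [hsum S hS, hsum T hT]
    _ = ∫ x, g x ∂μ := integral_congr_ae heq

variable {n : ℕ} {μ ν : Measure (E n)}

lemma isOptimalMap_gradient [IsFiniteMeasure μ] [IsFiniteMeasure ν]
    (hμ : IsCompact μ.support) (hν : IsCompact ν.support) {u : E n → ℝ} (hu : ConvexOn ℝ univ u)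
    (hdiff : ∀ᵐ x ∂μ, DifferentiableAt ℝ u x) (hT : MeasurePreserving (gradient u) μ ν) :
    IsOptimalMap μ ν (gradient u) := by
  refine ⟨hT, fun S hS => ?_⟩
  have : CompactSpace μ.support := isCompact_iff_compactSpace.1 hμ
  have hcont : Continuous u := hu.locallyLipschitz.continuous
  let uc : C(E n, ℝ) := ⟨u, hcont⟩
  let φ := legendre (uc.restrict μ.support)
  have hint : Integrable (fun x => inner ℝ x (S x)) μ := by
    refine ((integrable_of_isCompact_support hμ (f := fun x => ‖x‖ ^ 2) (by fun_prop)).add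
      (hS.integrable_comp_of_integrable (integrable_of_isCompact_support hν
        (f := fun x => ‖x‖ ^ 2) (by fun_prop)))).mono'
      (measurable_id.inner hS.measurable).aestronglyMeasurable (.of_forall fun x => ?_)
    refine (norm_inner_le_norm x (S x)).trans ?_
    simp only [Pi.add_apply, Function.comp_apply]
    nlinarith [sq_nonneg (‖x‖ - ‖S x‖), sq_nonneg ‖x‖, sq_nonneg ‖S x‖]
  simp only [cost, integral_neg, neg_le_neg_iff]
  refine integral_le_integral_of_le_add_comp hS hT (integrable_of_isCompact_support hμ hcont)
    (integrable_of_isCompact_support hν φ.continuous) hint ?_ ?_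
  · filter_upwards [Measure.support_mem_ae] with x hx
    have hle := inner_sub_le_legendre (uc.restrict μ.support) (S x) ⟨x, hx⟩
    rw [real_inner_comm] at hle
    exact sub_le_iff_le_add'.1 hle
  · filter_upwards [Measure.support_mem_ae, hdiff] with x hx hd
    rw [legendre_restrict_eq (u := uc) hx (gradient_mem_subdiff hu hd)]
    exact add_sub_cancel _ _

lemma measurable_gradient (u : E n → ℝ) : Measurable (gradient u) :=
  (InnerProductSpace.toDual ℝ (E n)).symm.continuous.measurable.comp (measurable_fderiv ℝ u)

lemma measurePreserving_coe_support {X : Type*} [TopologicalSpace X] [HereditarilyLindelofSpace X]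
    [MeasurableSpace X] [OpensMeasurableSpace X] (μ : Measure X) :
    MeasurePreserving ((↑) : μ.support → X) (μ.comap (↑)) μ := by
  have h := measurePreserving_subtype_coe (μa := μ)
    (Measure.isClosed_support (μ := μ)).measurableSet
  rwa [Measure.restrict_eq_self_of_ae_mem (s := μ.support) Measure.support_mem_ae] at h

lemma isProbabilityMeasure_comap_coe_support {X : Type*} [TopologicalSpace X]
    [HereditarilyLindelofSpace X] [MeasurableSpace X] [OpensMeasurableSpace X] (μ : Measure X)
    [IsProbabilityMeasure μ] : IsProbabilityMeasure (μ.comap ((↑) : μ.support → X)) := by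
  have hembedding := MeasurableEmbedding.subtype_coe
    (Measure.isClosed_support (μ := μ)).measurableSet
  refine hembedding.isProbabilityMeasure_comap ?_
  rw [Subtype.range_coe]
  exact Measure.support_mem_ae

lemma exists_measurePreserving_gradient_legendre [IsProbabilityMeasure μ] [IsProbabilityMeasure ν]
    [CompactSpace μ.support] [CompactSpace ν.support] [Nonempty ν.support] (hμ : μ ≪ volume) :
    ∃ ψ : C(ν.support, ℝ), MeasurePreserving (gradient (legendre ψ)) μ ν := by
  have hμ' := measurePreserving_coe_support μ
  have hν' := measurePreserving_coe_support ν
  have : IsProbabilityMeasure (μ.comap ((↑) : μ.support → E n)) :=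
    isProbabilityMeasure_comap_coe_support μ
  have : IsProbabilityMeasure (ν.comap ((↑) : ν.support → E n)) :=
    isProbabilityMeasure_comap_coe_support ν
  let b : C(μ.support × ν.support, ℝ) := ⟨fun z => inner ℝ (z.1 : E n) z.2, by fun_prop⟩
  obtain ⟨ψ, hψ⟩ := exists_forall_dualFunctional_le b (μ.comap (↑)) (ν.comap (↑))
  choose T hT using exists_sub_eq_cTransform b ψ
  obtain ⟨C, hC⟩ := (hasSubgradientsIn_legendre ψ).exists_lipschitzWith
    (isCompact_iff_compactSpace.2 ‹_›).isBounded
  have hdiff := hμ'.quasiMeasurePreserving.ae (hμ.ae_le hC.ae_differentiableAt)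
  have hmax : ∀ᵐ x ∂μ.comap ((↑) : μ.support → E n), ∀ y, b (x, y) - ψ y = cTransform b ψ x ↔
      y = T x := by
    filter_upwards [hdiff] with x hx y
    exact (inner_sub_eq_legendre_iff hx).trans
      ((inner_sub_eq_legendre_iff hx).1 (hT x) ▸ Subtype.ext_iff.symm)
  have hTgrad : (↑) ∘ T =ᵐ[μ.comap (↑)] gradient (legendre ψ) ∘ (↑) :=
    hdiff.mono fun x hx => (inner_sub_eq_legendre_iff hx).1 (hT x)
  have hgrad := measurable_gradient (legendre ψ)
  have hTmeas : AEMeasurable T (μ.comap (↑)) :=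
    (MeasurableEmbedding.subtype_coe Measure.isClosed_support.measurableSet).aemeasurable_comp_iff.1
      ((hgrad.comp measurable_subtype_coe).aemeasurable.congr hTgrad.symm)
  refine ⟨ψ, hgrad, ?_⟩
  calc μ.map (gradient (legendre ψ))
      = (μ.comap (↑)).map (gradient (legendre ψ) ∘ ((↑) : μ.support → E n)) := by
        rw [← Measure.map_map hgrad measurable_subtype_coe, hμ'.map_eq]
    _ = ((μ.comap (↑)).map T).map (↑) := by
        rw [AEMeasurable.map_map_of_aemeasurable measurable_subtype_coe.aemeasurable hTmeas,
          Measure.map_congr hTgrad]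
    _ = ν := by rw [map_eq_of_forall_dualFunctional_le hψ hTmeas hmax, hν'.map_eq]

lemma exists_isOptimalPotential [IsProbabilityMeasure μ] [IsProbabilityMeasure ν]
    (hac : μ ≪ volume) (hμ : IsCompact μ.support) (hν : IsCompact ν.support) :
    ∃ u, IsOptimalPotential μ ν u := by
  have : CompactSpace μ.support := isCompact_iff_compactSpace.1 hμ
  have : CompactSpace ν.support := isCompact_iff_compactSpace.1 hν
  have : Nonempty ν.support :=
    (Measure.nonempty_support (IsProbabilityMeasure.ne_zero ν)).to_subtype
  obtain ⟨ψ, hψ⟩ := exists_measurePreserving_gradient_legendre (ν := ν) hac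
  have hsub := hasSubgradientsIn_legendre ψ
  obtain ⟨C, hC⟩ := hsub.exists_lipschitzWith hν.isBounded
  exact ⟨legendre ψ, hsub.convexOn, hC.ae_differentiableAt,
    isOptimalMap_gradient hμ hν hsub.convexOn (hac.ae_le hC.ae_differentiableAt) hψ,
    fun x => hsub.gradient_mem⟩

variable {u : E n → ℝ} {Ω : Set (E n)}

lemma IsOptimalPotential.continuous (hu : IsOptimalPotential μ ν u) : Continuous u :=
  hu.convexOn.locallyLipschitz.continuous

lemma IsOptimalPotential.hasSubgradientsIn (hu : IsOptimalPotential μ ν u)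
    (hν : IsCompact ν.support) : HasSubgradientsIn ν.support u := fun x => by
  have hclosed : IsClosed {x | ∃ q ∈ ν.support, q ∈ subdiff u x} :=
    isClosed_setOf_exists_mem hν ((isClosed_setOf_mem_subdiff hu.continuous).preimage
      continuous_swap)
  obtain ⟨q, hq, hqx⟩ := hclosed.closure_subset_iff.2
    (fun y hy => ⟨_, hu.gradient_mem y hy, gradient_mem_subdiff hu.convexOn hy⟩)
    (Measure.dense_of_ae hu.ae_differentiableAt x)
  exact ⟨q, hqx, hq⟩

lemma IsOptimalPotential.exists_mem_subdiff (hu : IsOptimalPotential μ ν u) (hac : μ ≪ volume)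
    (hμ : IsCompact μ.support) {q : E n} (hq : q ∈ ν.support) :
    ∃ x ∈ μ.support, q ∈ subdiff u x := by
  have hclosed : IsClosed {q | ∃ x ∈ μ.support, q ∈ subdiff u x} :=
    isClosed_setOf_exists_mem hμ (isClosed_setOf_mem_subdiff hu.continuous)
  refine Measure.support_subset_of_isClosed hclosed ?_ hq
  have hT := hu.isOptimalMap.measurePreserving
  rw [← hT.map_eq, mem_ae_map_iff hT.measurable.aemeasurable hclosed.measurableSet]
  filter_upwards [Measure.support_mem_ae, hac.ae_le hu.ae_differentiableAt] with x hx hd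
  exact ⟨x, hx, gradient_mem_subdiff hu.convexOn hd⟩

lemma isConnected_setOf_exists_mem {X Y : Type*} [TopologicalSpace X] [TopologicalSpace Y]
    {A : Set X} (hA : IsCompact A) {B : Set Y} (hB : IsConnected B) {G : Set (X × Y)}
    (hG : IsClosed G) (hfiber : ∀ y ∈ B, IsConnected {x | x ∈ A ∧ (x, y) ∈ G}) :
    IsConnected {x | x ∈ A ∧ ∃ y ∈ B, (x, y) ∈ G} := by
  refine ⟨?_, isPreconnected_closed_iff.2 ?_⟩
  · obtain ⟨y, hy⟩ := hB.nonempty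
    obtain ⟨x, hx, hxy⟩ := (hfiber y hy).nonempty
    exact ⟨x, hx, y, hy, hxy⟩
  rintro s t hs ht hst ⟨x, ⟨hx, y, hy, hxy⟩, hxs⟩ ⟨x', ⟨hx', y', hy', hxy'⟩, hxt⟩
  have hclosed : ∀ s : Set X, IsClosed s → IsClosed {y | ∃ x ∈ A, x ∈ s ∧ (x, y) ∈ G} :=
    fun s hs => isClosed_setOf_exists_mem hA ((hs.preimage continuous_fst).inter hG)
  obtain ⟨z, hz, ⟨p, hp, hps, hpz⟩, q, hq, hqt, hqz⟩ :=
    isPreconnected_closed_iff.1 hB.isPreconnected _ _ (hclosed s hs) (hclosed t ht)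
      (fun z hz => by
        obtain ⟨p, hp, hpz⟩ := (hfiber z hz).nonempty
        exact (hst ⟨hp, z, hz, hpz⟩).imp (fun h => ⟨p, hp, h, hpz⟩) fun h => ⟨p, hp, h, hpz⟩)
      ⟨y, hy, x, hx, hxs, hxy⟩ ⟨y', hy', x', hx', hxt, hxy'⟩
  obtain ⟨r, ⟨hr, hrz⟩, hrst⟩ :=
    isPreconnected_closed_iff.1 (hfiber z hz).isPreconnected s t hs ht
      (fun r hr => hst ⟨hr.1, z, hz, hr.2⟩) ⟨p, ⟨hp, hpz⟩, hps⟩ ⟨q, ⟨hq, hqz⟩, hqt⟩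
  exact ⟨r, ⟨hr, z, hz, hrz⟩, hrst⟩

lemma IsOptimalPotential.isConnected_support_inter (hu : IsOptimalPotential μ ν u)
    (hac : μ ≪ volume) (hμ : IsCompact μ.support) (hconvex : Convex ℝ μ.support)
    (hΩ : IsConnected Ω) (hΩν : Ω ⊆ ν.support) :
    IsConnected (μ.support ∩ {x | (subdiff u x ∩ Ω).Nonempty}) := by
  have hfiber : ∀ q ∈ Ω, IsConnected (μ.support ∩ {x | q ∈ subdiff u x}) := fun q hq => by
    obtain ⟨x, hx, hqx⟩ := hu.exists_mem_subdiff hac hμ (hΩν hq)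
    exact (hconvex.inter (convex_setOf_mem_subdiff hu.convexOn q)).isConnected ⟨x, hx, hqx⟩
  simp only [inter_comm _ Ω]
  exact isConnected_setOf_exists_mem hμ hΩ (isClosed_setOf_mem_subdiff hu.continuous) hfiber

end OptimalPotentials

section SlopeParts

variable {n : ℕ} {u w w₁ w₂ : E n → ℝ} {Ω Ω₁ Ω₂ : Set (E n)}

/-- `w` is the part of `u` with slopes in `Ω`: it is the supremum of the affine functions that
support `u` and have slope in `Ω`. -/
structure IsSlopePart (Ω : Set (E n)) (u w : E n → ℝ) : Prop where
  le : ∀ x, w x ≤ u x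
  hasSubgradientsIn : HasSubgradientsIn Ω w
  eq_of_nonempty : ∀ x, (subdiff u x ∩ Ω).Nonempty → w x = u x

lemma IsSlopePart.eq_iff (hw : IsSlopePart Ω u w) {x : E n} :
    w x = u x ↔ (subdiff u x ∩ Ω).Nonempty := by
  refine ⟨fun h => ?_, hw.eq_of_nonempty x⟩
  obtain ⟨p, hp, hpΩ⟩ := hw.hasSubgradientsIn x
  exact ⟨p, fun y => h ▸ (hp y).trans (hw.le y), hpΩ⟩

lemma exists_isSlopePart {A : Set (E n)} (hA : IsCompact A) (hΩ : IsCompact Ω) (hne : Ω.Nonempty)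
    (hu : Continuous u) (hsub : ∀ q ∈ Ω, ∃ x ∈ A, q ∈ subdiff u x) : ∃ w, IsSlopePart Ω u w := by
  have : CompactSpace A := isCompact_iff_compactSpace.1 hA
  have : CompactSpace Ω := isCompact_iff_compactSpace.1 hΩ
  have : Nonempty Ω := hne.to_subtype
  let uc : C(E n, ℝ) := ⟨u, hu⟩
  let ψ : C(Ω, ℝ) := (legendre (uc.restrict A)).restrict Ω
  have hψ : ∀ q : Ω, ∃ x, (q : E n) ∈ subdiff u x ∧ ψ q = inner ℝ x q - u x := fun q => by
    obtain ⟨x, hxA, hqx⟩ := hsub q q.2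
    exact ⟨x, hqx, legendre_restrict_eq (u := uc) hxA hqx⟩
  have hle : ∀ x, legendre ψ x ≤ u x := fun x => by
    obtain ⟨q, hq⟩ := exists_inner_sub_eq_legendre ψ x
    obtain ⟨x', hqx', hψq⟩ := hψ q
    have hsupport := hqx' x
    rw [inner_sub_left] at hsupport
    linarith
  refine ⟨legendre ψ, hle, hasSubgradientsIn_legendre ψ,
    fun x ⟨q, hqx, hqΩ⟩ => le_antisymm (hle x) ?_⟩
  obtain ⟨x', -, hψq⟩ := hψ ⟨q, hqΩ⟩
  have hsupport := hqx x'
  rw [inner_sub_left] at hsupport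
  linarith [inner_sub_le_legendre ψ x ⟨q, hqΩ⟩]

lemma IsSlopePart.eq_max (h₁ : IsSlopePart Ω₁ u w₁) (h₂ : IsSlopePart Ω₂ u w₂)
    (hu : HasSubgradientsIn (Ω₁ ∪ Ω₂) u) (x : E n) : u x = max (w₁ x) (w₂ x) := by
  refine le_antisymm (le_max_iff.2 ?_) (max_le (h₁.le x) (h₂.le x))
  obtain ⟨p, hp, hpΩ | hpΩ⟩ := hu x
  · exact .inl (h₁.eq_of_nonempty x ⟨p, hp, hpΩ⟩).ge
  · exact .inr (h₂.eq_of_nonempty x ⟨p, hp, hpΩ⟩).ge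

lemma tear_comm : tear u Ω₁ Ω₂ = tear u Ω₂ Ω₁ :=
  inter_comm _ _

lemma IsSlopePart.tear_eq (h₁ : IsSlopePart Ω₁ u w₁) (h₂ : IsSlopePart Ω₂ u w₂)
    (hu : HasSubgradientsIn (Ω₁ ∪ Ω₂) u) : tear u Ω₁ Ω₂ = {x | w₁ x = w₂ x} := by
  ext x
  simp only [tear, mem_ofPred_eq, ← h₁.eq_iff, ← h₂.eq_iff, h₁.eq_max h₂ hu x, left_eq_sup,
    right_eq_sup]
  exact and_comm.trans le_antisymm_iff.symm

lemma IsSlopePart.missing_eq (h₁ : IsSlopePart Ω₁ u w₁) (h₂ : IsSlopePart Ω₂ u w₂)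
    (hu : HasSubgradientsIn (Ω₁ ∪ Ω₂) u) : missing u Ω₂ = {x | w₂ x < w₁ x} := by
  ext x
  simp only [missing, mem_ofPred_eq, ← not_nonempty_iff_eq_empty, ← h₂.eq_iff, h₁.eq_max h₂ hu x,
    right_eq_sup, not_le]

lemma missing_union_tear (hu : HasSubgradientsIn (Ω₁ ∪ Ω₂) u) :
    missing u Ω₂ ∪ tear u Ω₁ Ω₂ = {x | (subdiff u x ∩ Ω₁).Nonempty} := by
  ext x
  have hx := hu x
  rw [inter_union_distrib_left, union_nonempty] at hx
  simp only [missing, tear, mem_union, mem_ofPred_eq, ← not_nonempty_iff_eq_empty]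
  tauto

end SlopeParts

section Growth

variable {F : Type*} [AddCommGroup F] [Module ℝ F] {f g h u w₁ w₂ : F → ℝ} {v : F}
  {m k b₁ b₂ s : ℝ}

/-- `f` grows along every line of direction `v` with slope at least `m`. -/
def GrowsAlong (v : F) (m : ℝ) (f : F → ℝ) : Prop :=
  ∀ x t, 0 ≤ t → f x + t * m ≤ f (x + t • v)

lemma GrowsAlong.add (hf : GrowsAlong v m f) (hg : GrowsAlong v k g) :
    GrowsAlong v (m + k) (f + g) := fun x t ht => by
  simp only [Pi.add_apply, mul_add]
  linarith [hf x t ht, hg x t ht]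

lemma GrowsAlong.add_mul_le (hf : GrowsAlong v m f) (x : F) {s t : ℝ} (hst : s ≤ t) :
    f (x + s • v) + (t - s) * m ≤ f (x + t • v) := by
  simpa only [add_assoc, ← add_smul, add_sub_cancel] using
    hf (x + s • v) (t - s) (sub_nonneg.2 hst)

lemma GrowsAlong.strictMono (hf : GrowsAlong v m f) (hm : 0 < m) (x : F) :
    StrictMono fun t : ℝ => f (x + t • v) := fun _ _ hst =>
  (lt_add_of_pos_right _ (mul_pos (sub_pos.2 hst) hm)).trans_le (hf.add_mul_le x hst.le)

lemma GrowsAlong.surjective [TopologicalSpace F] [ContinuousAdd F] [ContinuousSMul ℝ F]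
    (hf : GrowsAlong v m f) (hm : 0 < m) (hcont : Continuous f) (x : F) :
    Function.Surjective fun t : ℝ => f (x + t • v) := by
  have hneg : ∀ t ≤ 0, f (x + t • v) ≤ f x + t * m := fun t ht => by
    have hgrow := hf.add_mul_le x ht
    rw [zero_smul, add_zero] at hgrow
    linarith
  refine Continuous.surjective (by fun_prop) ?_ ?_
  · exact tendsto_atTop_mono' _ ((eventually_ge_atTop 0).mono (hf x))
      (tendsto_atTop_add_const_left _ _ (tendsto_id.atTop_mul_const hm))
  · exact tendsto_atBot_mono' _ ((eventually_le_atBot 0).mono hneg)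
      (tendsto_atBot_add_const_left _ _ (tendsto_id.atBot_mul_const hm))

lemma GrowsAlong.lipschitzWith_height {F : Type*} [SeminormedAddCommGroup F] [NormedSpace ℝ F]
    {f h : F → ℝ} {v : F} (hf : GrowsAlong v m f) (hm : 0 < m) {K : ℝ≥0}
    (hK : LipschitzWith K f) (hh : ∀ p, f (p + h p • v) = 0) :
    LipschitzWith (K / m.toNNReal) h := by
  refine LipschitzWith.of_le_add_mul _ fun p q => ?_
  rcases le_total (h p) (h q) with hpq | hqp
  · exact hpq.trans (le_add_of_nonneg_right (by positivity))
  have hgrow := hf.add_mul_le q hqp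
  have hlip := hK.le_add_mul (q + h p • v) (p + h p • v)
  rw [dist_add_right, dist_comm, hh] at hlip
  rw [hh] at hgrow
  rw [← sub_le_iff_le_add', NNReal.coe_div, Real.coe_toNNReal _ hm.le, div_mul_eq_mul_div,
    le_div_iff₀ hm]
  linarith

lemma GrowsAlong.max_add_mul_le (h₁ : GrowsAlong v b₁ w₁) (h₂ : GrowsAlong v (-b₂) (-w₂))
    (hs : s ∈ Icc b₂ b₁) {x : F} (hx : w₁ x = w₂ x) (t : ℝ) :
    max (w₁ x) (w₂ x) + t * s ≤ max (w₁ (x + t • v)) (w₂ (x + t • v)) := by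
  rw [hx, max_self]
  rcases le_total 0 t with ht | ht
  · refine le_max_of_le_left ?_
    linarith [h₁ x t ht, mul_le_mul_of_nonneg_left hs.2 ht]
  · have hgrow := h₂.add_mul_le x ht
    simp only [zero_smul, add_zero, Pi.neg_apply] at hgrow
    refine le_max_of_le_right ?_
    linarith [mul_le_mul_of_nonpos_left hs.1 ht]

-- The function is the minimum over `t` of `u (p + t • v) - t * s`, which is jointly convex.
lemma convexOn_sub_mul_of_forall_le (hu : ConvexOn ℝ univ u)
    (hmin : ∀ p t, u (p + h p • v) + (t - h p) * s ≤ u (p + t • v)) :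
    ConvexOn ℝ univ fun p => u (p + h p • v) - h p * s := by
  refine ⟨convex_univ, fun p _ q _ α β hα hβ hαβ => ?_⟩
  have hle := hmin (α • p + β • q) (α * h p + β * h q)
  have hconvex := hu.2 (mem_univ (p + h p • v)) (mem_univ (q + h q • v)) hα hβ hαβ
  rw [show α • (p + h p • v) + β • (q + h q • v)
    = α • p + β • q + (α * h p + β * h q) • v by module] at hconvex
  simp only [smul_eq_mul] at hconvex ⊢
  linarith

lemma exists_convexOn_sub_convexOn (hu : ConvexOn ℝ univ fun x => max (w₁ x) (w₂ x))
    (h₁ : GrowsAlong v b₁ w₁) (h₂ : GrowsAlong v (-b₂) (-w₂)) (hb : b₂ < b₁)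
    (hh : ∀ p, w₁ (p + h p • v) = w₂ (p + h p • v)) :
    ∃ f g : F → ℝ, ConvexOn ℝ univ f ∧ ConvexOn ℝ univ g ∧ ∀ p, h p = f p - g p := by
  have htilt : ∀ s ∈ Icc b₂ b₁, ConvexOn ℝ univ fun p => w₁ (p + h p • v) - h p * s := by
    intro s hs
    have hmin := convexOn_sub_mul_of_forall_le (v := v) (h := h) (s := s) hu fun p t => by
      simpa only [add_assoc, ← add_smul, add_sub_cancel] using
        h₁.max_add_mul_le h₂ hs (hh p) (t - h p)
    simpa only [← hh, max_self] using hmin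
  have hpos : 0 < b₁ - b₂ := sub_pos.2 hb
  refine ⟨_, _, (htilt b₂ ⟨le_rfl, hb.le⟩).smul (inv_pos.2 hpos).le,
    (htilt b₁ ⟨hb.le, le_rfl⟩).smul (inv_pos.2 hpos).le, fun p => ?_⟩
  simp only [smul_eq_mul]
  field_simp
  ring

end Growth

section Graphs

variable {n : ℕ} {v : E n} {a : ℝ} {P : Set (E n)} {f h : E n → ℝ}

lemma convex_hyperplane : Convex ℝ (hyperplane v a) := by
  intro x hx y hy s t _ _ hst
  simp only [hyperplane, mem_ofPred_eq, inner_add_left, real_inner_smul_left] at *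
  rw [hx, hy, ← add_mul, hst, one_mul]

lemma exists_mem_hyperplane_eq_add_smul (hv : v ≠ 0) (a : ℝ) (x : E n) :
    ∃ p ∈ hyperplane v a, ∃ t : ℝ, x = p + t • v := by
  refine ⟨x - ((inner ℝ x v - a) / inner ℝ v v) • v, ?_, (inner ℝ x v - a) / inner ℝ v v,
    by module⟩
  rw [hyperplane, mem_ofPred_eq, inner_sub_left, real_inner_smul_left,
    div_mul_cancel₀ _ (inner_self_ne_zero.2 hv), sub_sub_cancel]

lemma isConnected_hyperplane (hv : v ≠ 0) (a : ℝ) : IsConnected (hyperplane v a) := by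
  obtain ⟨p, hp, -⟩ := exists_mem_hyperplane_eq_add_smul hv a 0
  exact convex_hyperplane.isConnected ⟨p, hp⟩

lemma isConnected_graphOver (hP : IsConnected P) (hh : Continuous h) :
    IsConnected (graphOver v P h) := by
  have himage : graphOver v P h = (fun p => p + h p • v) '' P := by
    ext x
    simp only [graphOver, mem_ofPred_eq, mem_image, eq_comm]
  rw [himage]
  exact hP.image _ (by fun_prop)

lemma isConnected_openEpigraphOver (hP : IsConnected P) (hh : Continuous h) :
    IsConnected (openEpigraphOver v P h) := by
  have himage : openEpigraphOver v P h =
      (fun z : E n × ℝ => z.1 + (h z.1 + z.2) • v) '' (P ×ˢ Ioi 0) := by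
    ext x
    constructor
    · rintro ⟨p, hp, t, ht, rfl⟩
      exact ⟨(p, t - h p), ⟨hp, sub_pos.2 ht⟩, by simp only [add_sub_cancel]⟩
    · rintro ⟨⟨p, t⟩, ⟨hp, ht⟩, rfl⟩
      exact ⟨p, hp, h p + t, lt_add_of_pos_right _ ht, rfl⟩
  rw [himage]
  exact (hP.prod isConnected_Ioi).image _ (by fun_prop)

lemma openSubgraphOver_eq : openSubgraphOver v P h = openEpigraphOver (-v) P (-h) := by
  ext x
  simp only [openSubgraphOver, openEpigraphOver, mem_ofPred_eq, Pi.neg_apply]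
  refine exists_congr fun p => and_congr_right fun _ => (Equiv.neg ℝ).exists_congr fun t => ?_
  simp only [Equiv.neg_apply, neg_lt_neg_iff, neg_smul_neg]

lemma isConnected_openSubgraphOver (hP : IsConnected P) (hh : Continuous h) :
    IsConnected (openSubgraphOver v P h) :=
  openSubgraphOver_eq ▸ isConnected_openEpigraphOver hP hh.neg

lemma setOf_eq_zero_eq_graphOver (hP : ∀ x, ∃ p ∈ P, ∃ t : ℝ, x = p + t • v)
    (hf : ∀ x, StrictMono fun t : ℝ => f (x + t • v)) (hh : ∀ p, f (p + h p • v) = 0) :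
    {x | f x = 0} = graphOver v P h := by
  refine Subset.antisymm (fun x hx => ?_) fun x ⟨p, _, hx⟩ => hx ▸ hh p
  obtain ⟨p, hp, t, rfl⟩ := hP x
  exact ⟨p, hp, by rw [(hf p).injective ((hh p).trans hx.symm)]⟩

lemma setOf_pos_eq_openEpigraphOver (hP : ∀ x, ∃ p ∈ P, ∃ t : ℝ, x = p + t • v)
    (hf : ∀ x, StrictMono fun t : ℝ => f (x + t • v)) (hh : ∀ p, f (p + h p • v) = 0) :
    {x | 0 < f x} = openEpigraphOver v P h := by
  refine Subset.antisymm (fun x hx => ?_) fun x ⟨p, _, t, ht, hx⟩ =>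
    hx ▸ (hh p).symm.trans_lt (hf p ht)
  obtain ⟨p, hp, t, rfl⟩ := hP x
  exact ⟨p, hp, t, (hf p).lt_iff_lt.1 ((hh p).trans_lt hx), rfl⟩

lemma setOf_neg_eq_openSubgraphOver (hP : ∀ x, ∃ p ∈ P, ∃ t : ℝ, x = p + t • v)
    (hf : ∀ x, StrictMono fun t : ℝ => f (x + t • v)) (hh : ∀ p, f (p + h p • v) = 0) :
    {x | f x < 0} = openSubgraphOver v P h := by
  refine Subset.antisymm (fun x hx => ?_) fun x ⟨p, _, t, ht, hx⟩ =>
    hx ▸ (hf p ht).trans_eq (hh p)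
  obtain ⟨p, hp, t, rfl⟩ := hP x
  exact ⟨p, hp, t, (hf p).lt_iff_lt.1 (hx.trans_eq (hh p).symm), rfl⟩

end Graphs

section Tears

variable {n : ℕ} {μ ν : Measure (E n)} {u w w₁ w₂ : E n → ℝ} {Ω Ω₁ Ω₂ : Set (E n)} {v : E n}
  {a b b₁ b₂ : ℝ}

lemma HasSubgradientsIn.growsAlong (hw : HasSubgradientsIn Ω w) (hΩ : ∀ p ∈ Ω, b ≤ inner ℝ p v) :
    GrowsAlong v b w := fun x t ht => by
  obtain ⟨p, hp, hpΩ⟩ := hw x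
  have hsupport := hp (x + t • v)
  rw [add_sub_cancel_left, real_inner_smul_left, real_inner_comm] at hsupport
  linarith [mul_le_mul_of_nonneg_left (hΩ p hpΩ) ht]

lemma HasSubgradientsIn.growsAlong_neg (hw : HasSubgradientsIn Ω w)
    (hΩ : ∀ p ∈ Ω, inner ℝ p v ≤ b) : GrowsAlong v (-b) (-w) := fun x t ht => by
  obtain ⟨p, hp, hpΩ⟩ := hw (x + t • v)
  have hsupport := hp x
  rw [sub_add_cancel_left, inner_neg_left, real_inner_smul_left, real_inner_comm] at hsupport
  simp only [Pi.neg_apply]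
  linarith [mul_le_mul_of_nonneg_left (hΩ p hpΩ) ht]

lemma exists_isDCOn_setOf_eq_graphOver (hc₁ : ConvexOn ℝ univ w₁) (hc₂ : ConvexOn ℝ univ w₂)
    {K₁ K₂ : ℝ≥0} (hK₁ : LipschitzWith K₁ w₁) (hK₂ : LipschitzWith K₂ w₂)
    (h₁ : GrowsAlong v b₁ w₁) (h₂ : GrowsAlong v (-b₂) (-w₂)) (hb : b₂ < b₁)
    {P : Set (E n)} (hPc : Convex ℝ P) (hP : ∀ x, ∃ p ∈ P, ∃ t : ℝ, x = p + t • v) :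
    ∃ h : E n → ℝ, IsDCOn P h ∧ (∃ K, LipschitzWith K h) ∧
      {x | w₁ x = w₂ x} = graphOver v P h ∧ {x | w₂ x < w₁ x} = openEpigraphOver v P h ∧
      {x | w₁ x < w₂ x} = openSubgraphOver v P h := by
  have hpos : 0 < b₁ + -b₂ := by linarith
  have hgrow := h₁.add h₂
  have hlip : LipschitzWith (K₁ + K₂) (w₁ + -w₂) := hK₁.add hK₂.neg
  choose h hh using fun p => hgrow.surjective hpos hlip.continuous p 0
  have hzero : ∀ p, w₁ (p + h p • v) = w₂ (p + h p • v) := fun p => add_neg_eq_zero.1 (hh p)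
  obtain ⟨f, g, hf, hg, hfg⟩ := exists_convexOn_sub_convexOn (hc₁.sup hc₂) h₁ h₂ hb hzero
  have hmono := hgrow.strictMono hpos
  refine ⟨h, ⟨f, g, hf.subset (subset_univ P) hPc, hg.subset (subset_univ P) hPc, fun p _ => hfg p⟩,
    ⟨_, hgrow.lipschitzWith_height hpos hlip hh⟩, ?_, ?_, ?_⟩
  · simpa only [Pi.add_apply, Pi.neg_apply, add_neg_eq_zero] using
      setOf_eq_zero_eq_graphOver hP hmono hh
  · simpa only [Pi.add_apply, Pi.neg_apply, lt_add_neg_iff_lt] using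
      setOf_pos_eq_openEpigraphOver hP hmono hh
  · simpa only [Pi.add_apply, Pi.neg_apply, add_neg_lt_iff_lt_add, zero_add] using
      setOf_neg_eq_openSubgraphOver hP hmono hh

lemma StronglySeparates.ne_zero (hsep : StronglySeparates v a Ω₁ Ω₂) : v ≠ 0 :=
  norm_ne_zero_iff.1 (hsep.1 ▸ one_ne_zero)

lemma StronglySeparates.exists_lt (hsep : StronglySeparates v a Ω₁ Ω₂) (hΩ₁ : Ω₁.Nonempty)
    (hΩ₂ : Ω₂.Nonempty) :
    ∃ b₁ b₂, b₁ < b₂ ∧ (∀ p ∈ Ω₁, inner ℝ p v ≤ b₁) ∧ ∀ p ∈ Ω₂, b₂ ≤ inner ℝ p v := by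
  obtain ⟨-, d, hd, hlt⟩ := hsep
  obtain ⟨p₁, hp₁⟩ := hΩ₁
  obtain ⟨p₂, hp₂⟩ := hΩ₂
  exact ⟨a - d, a + d, by linarith, fun p hp => (hlt p hp p₂ hp₂).1.le,
    fun p hp => (hlt p₁ hp₁ p hp).2.le⟩

lemma StronglySeparates.separatedNhds (hsep : StronglySeparates v a Ω₁ Ω₂) (hΩ₁ : Ω₁.Nonempty)
    (hΩ₂ : Ω₂.Nonempty) : SeparatedNhds Ω₁ Ω₂ := by
  obtain ⟨b₁, b₂, hb, h₁, h₂⟩ := hsep.exists_lt hΩ₁ hΩ₂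
  obtain ⟨b, hb₁, hb₂⟩ := exists_between hb
  have hcont : Continuous fun x : E n => (inner ℝ x v : ℝ) := by fun_prop
  exact ⟨_, _, isOpen_Iio.preimage hcont, isOpen_Ioi.preimage hcont,
    fun p hp => (h₁ p hp).trans_lt hb₁, fun p hp => hb₂.trans_le (h₂ p hp),
    (Iio_disjoint_Ioi_same (a := b)).preimage _⟩

lemma StronglySeparates.isCompact (hsep : StronglySeparates v a Ω₁ Ω₂) (hΩ₁ : Ω₁.Nonempty)
    (hΩ₂ : Ω₂.Nonempty) (hunion : IsCompact (Ω₁ ∪ Ω₂)) : IsCompact Ω₁ ∧ IsCompact Ω₂ := by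
  have hclosed := (hsep.separatedNhds hΩ₁ hΩ₂).isClosed_union_iff.1 hunion.isClosed
  exact ⟨hunion.of_isClosed_subset hclosed.1 subset_union_left,
    hunion.of_isClosed_subset hclosed.2 subset_union_right⟩

lemma IsSlopePart.exists_isDCOn_tear_eq_graphOver (h₁ : IsSlopePart Ω₁ u w₁)
    (h₂ : IsSlopePart Ω₂ u w₂) (hu : HasSubgradientsIn (Ω₁ ∪ Ω₂) u)
    (hΩ₁ : Bornology.IsBounded Ω₁) (hΩ₂ : Bornology.IsBounded Ω₂)
    (hsep : StronglySeparates v a Ω₂ Ω₁) :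
    ∃ h : E n → ℝ, IsDCOn (hyperplane v a) h ∧ (∃ K, LipschitzWith K h) ∧
      tear u Ω₁ Ω₂ = graphOver v (hyperplane v a) h ∧
      missing u Ω₂ = openEpigraphOver v (hyperplane v a) h ∧
      missing u Ω₁ = openSubgraphOver v (hyperplane v a) h := by
  obtain ⟨b₂, b₁, hb, hslope₂, hslope₁⟩ :=
    hsep.exists_lt (h₂.hasSubgradientsIn 0).right (h₁.hasSubgradientsIn 0).right
  obtain ⟨K₁, hK₁⟩ := h₁.hasSubgradientsIn.exists_lipschitzWith hΩ₁
  obtain ⟨K₂, hK₂⟩ := h₂.hasSubgradientsIn.exists_lipschitzWith hΩ₂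
  rw [h₁.tear_eq h₂ hu, h₁.missing_eq h₂ hu, h₂.missing_eq h₁ (union_comm Ω₁ Ω₂ ▸ hu)]
  exact exists_isDCOn_setOf_eq_graphOver h₁.hasSubgradientsIn.convexOn
    h₂.hasSubgradientsIn.convexOn hK₁ hK₂ (h₁.hasSubgradientsIn.growsAlong hslope₁)
    (h₂.hasSubgradientsIn.growsAlong_neg hslope₂) hb convex_hyperplane
    (exists_mem_hyperplane_eq_add_smul hsep.ne_zero a)

lemma IsOptimalPotential.exists_isSlopePart (hu : IsOptimalPotential μ ν u) (hac : μ ≪ volume)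
    (hμ : IsCompact μ.support) (hΩ : IsCompact Ω) (hne : Ω.Nonempty) (hΩν : Ω ⊆ ν.support) :
    ∃ w, IsSlopePart Ω u w :=
  DCTears.exists_isSlopePart hμ hΩ hne hu.continuous fun _ hq =>
    hu.exists_mem_subdiff hac hμ (hΩν hq)

end Tears

end DCTears

open DCTears in
theorem mainTheorem4_general {n : ℕ} (μ ν : Measure (E n))
    [IsProbabilityMeasure μ] [IsProbabilityMeasure ν]
    (hμ : μ ≪ volume)
    (hμb : Bornology.IsBounded μ.support) (hνb : Bornology.IsBounded ν.support)
    (Ω₁ Ω₂ : Set (E n)) (hΩ₁ : Ω₁.Nonempty) (hΩ₂ : Ω₂.Nonempty)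
    (hsplit : ν.support = Ω₁ ∪ Ω₂)
    (v : E n) (a : ℝ) (hsep : StronglySeparates v a Ω₂ Ω₁) :
    (∃ u : E n → ℝ, IsOptimalPotential μ ν u) ∧
    ∀ u : E n → ℝ, IsOptimalPotential μ ν u →
      (∃ u₁ u₂ : E n → ℝ,
        ConvexOn ℝ univ u₁ ∧ ConvexOn ℝ univ u₂ ∧
        (∀ x, u x = max (u₁ x) (u₂ x)) ∧
        (∀ x, DifferentiableAt ℝ u₁ x → gradient u₁ x ∈ Ω₁) ∧
        (∀ x, DifferentiableAt ℝ u₂ x → gradient u₂ x ∈ Ω₂) ∧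
        tear u Ω₁ Ω₂ = {x | u₁ x = u₂ x} ∧
        missing u Ω₂ = {x | u₂ x < u₁ x} ∧
        missing u Ω₁ = {x | u₁ x < u₂ x}) ∧
      IsConnected (tear u Ω₁ Ω₂) ∧
      IsConnected (missing u Ω₂) ∧
      IsConnected (missing u Ω₁) ∧
      (∃ h : E n → ℝ,
        IsDCOn (hyperplane v a) h ∧
        (∃ K : ℝ≥0, LipschitzOnWith K h (hyperplane v a)) ∧
        tear u Ω₁ Ω₂ = graphOver v (hyperplane v a) h ∧
        missing u Ω₂ = openEpigraphOver v (hyperplane v a) h ∧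
        missing u Ω₁ = openSubgraphOver v (hyperplane v a) h) ∧
      (Convex ℝ μ.support → IsConnected Ω₁ →
        IsConnected (μ.support ∩ (missing u Ω₂ ∪ tear u Ω₁ Ω₂))) ∧
      (Convex ℝ μ.support → IsConnected Ω₂ →
        IsConnected (μ.support ∩ (missing u Ω₁ ∪ tear u Ω₁ Ω₂))) := by
  have hμc : IsCompact μ.support :=
    Metric.isCompact_of_isClosed_isBounded Measure.isClosed_support hμb
  have hνc : IsCompact ν.support :=
    Metric.isCompact_of_isClosed_isBounded Measure.isClosed_support hνb
  have hν₁ : Ω₁ ⊆ ν.support := hsplit ▸ subset_union_left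
  have hν₂ : Ω₂ ⊆ ν.support := hsplit ▸ subset_union_right
  obtain ⟨hc₂, hc₁⟩ := hsep.isCompact hΩ₂ hΩ₁ (union_comm Ω₁ Ω₂ ▸ hsplit ▸ hνc)
  refine ⟨exists_isOptimalPotential hμ hμc hνc, fun u hu => ?_⟩
  have hsub : HasSubgradientsIn (Ω₁ ∪ Ω₂) u := hsplit ▸ hu.hasSubgradientsIn hνc
  have hsub' : HasSubgradientsIn (Ω₂ ∪ Ω₁) u := union_comm Ω₁ Ω₂ ▸ hsub
  obtain ⟨u₁, h₁⟩ := hu.exists_isSlopePart hμ hμc hc₁ hΩ₁ hν₁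
  obtain ⟨u₂, h₂⟩ := hu.exists_isSlopePart hμ hμc hc₂ hΩ₂ hν₂
  obtain ⟨h, hdc, ⟨K, hK⟩, htear, hmissing₂, hmissing₁⟩ :=
    h₁.exists_isDCOn_tear_eq_graphOver h₂ hsub hc₁.isBounded hc₂.isBounded hsep
  have hplane := isConnected_hyperplane hsep.ne_zero a
  refine ⟨⟨u₁, u₂, h₁.hasSubgradientsIn.convexOn, h₂.hasSubgradientsIn.convexOn,
      h₁.eq_max h₂ hsub, fun x => h₁.hasSubgradientsIn.gradient_mem,
      fun x => h₂.hasSubgradientsIn.gradient_mem, h₁.tear_eq h₂ hsub, h₁.missing_eq h₂ hsub,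
      h₂.missing_eq h₁ hsub'⟩,
    htear ▸ isConnected_graphOver hplane hK.continuous,
    hmissing₂ ▸ isConnected_openEpigraphOver hplane hK.continuous,
    hmissing₁ ▸ isConnected_openSubgraphOver hplane hK.continuous,
    ⟨h, hdc, ⟨K, hK.lipschitzOnWith⟩, htear, hmissing₂, hmissing₁⟩, ?_, ?_⟩
  · exact missing_union_tear hsub ▸ fun hconv hconn =>
      hu.isConnected_support_inter hμ hμc hconv hconn hν₁
  · exact tear_comm (u := u) ▸ missing_union_tear hsub' ▸ fun hconv hconn =>
      hu.isConnected_support_inter hμ hμc hconv hconn hν₂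

theorem mainTheorem4 {n : ℕ} (μ ν : Measure (DCTears.E n))
    [IsProbabilityMeasure μ] [IsProbabilityMeasure ν]
    (hμ : μ ≪ volume) (hν : ν ≪ volume)
    (hμb : Bornology.IsBounded μ.support) (hνb : Bornology.IsBounded ν.support)
    (Ω₁ Ω₂ : Set (DCTears.E n)) (hΩ₁ : Ω₁.Nonempty) (hΩ₂ : Ω₂.Nonempty)
    (hsplit : ν.support = Ω₁ ∪ Ω₂)
    (v : DCTears.E n) (a : ℝ) (hsep : DCTears.StronglySeparates v a Ω₂ Ω₁) :
    (∃ u : DCTears.E n → ℝ, DCTears.IsOptimalPotential μ ν u) ∧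
    ∀ u : DCTears.E n → ℝ, DCTears.IsOptimalPotential μ ν u →
      (∃ u₁ u₂ : DCTears.E n → ℝ,
        ConvexOn ℝ univ u₁ ∧ ConvexOn ℝ univ u₂ ∧
        (∀ x, u x = max (u₁ x) (u₂ x)) ∧
        (∀ x, DifferentiableAt ℝ u₁ x → gradient u₁ x ∈ Ω₁) ∧
        (∀ x, DifferentiableAt ℝ u₂ x → gradient u₂ x ∈ Ω₂) ∧
        DCTears.tear u Ω₁ Ω₂ = {x | u₁ x = u₂ x} ∧
        DCTears.missing u Ω₂ = {x | u₂ x < u₁ x} ∧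
        DCTears.missing u Ω₁ = {x | u₁ x < u₂ x}) ∧
      IsConnected (DCTears.tear u Ω₁ Ω₂) ∧
      IsConnected (DCTears.missing u Ω₂) ∧
      IsConnected (DCTears.missing u Ω₁) ∧
      (∃ h : DCTears.E n → ℝ,
        DCTears.IsDCOn (DCTears.hyperplane v a) h ∧
        (∃ K : ℝ≥0, LipschitzOnWith K h (DCTears.hyperplane v a)) ∧
        DCTears.tear u Ω₁ Ω₂ = DCTears.graphOver v (DCTears.hyperplane v a) h ∧
        DCTears.missing u Ω₂ = DCTears.openEpigraphOver v (DCTears.hyperplane v a) h ∧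
        DCTears.missing u Ω₁ = DCTears.openSubgraphOver v (DCTears.hyperplane v a) h) ∧
      (Convex ℝ μ.support → IsConnected Ω₁ →
        IsConnected (μ.support ∩ (DCTears.missing u Ω₂ ∪ DCTears.tear u Ω₁ Ω₂))) ∧
      (Convex ℝ μ.support → IsConnected Ω₂ →
        IsConnected (μ.support ∩ (DCTears.missing u Ω₁ ∪ DCTears.tear u Ω₁ Ω₂))) :=
  mainTheorem4_general μ ν hμ hμb hνb Ω₁ Ω₂ hΩ₁ hΩ₂ hsplit v a hsep
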